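/- \textbf{Theorem 1 (Sample kurtosis).} Let $y_1, y_2, \dots$ be i.i.d. real random variables and, for $n \ge 1$, put $\bar y = \frac1n\sum_{i=1}^n y_i$ and $$Z_n = \frac{\frac1n\sum_{i=1}^n (y_i-\bar y)^4}{\left(\frac1n\sum_{i=1}^n (y_i-\bar y)^2\right)^2}.$$ For $\varphi>0$ and $\nu>0$ let $t(0,\varphi,\nu)$ be the Student distribution with $\nu$ degrees of freedom, centre $0$ and squared scale $\varphi$, that is, the distribution on $\mathbb R$ with density $$x \mapsto \frac{\Gamma(\frac{\nu+1}{2})}{\Gamma(\frac{\nu}{2})\sqrt{\nu\pi\varphi}}\left(1+\frac{x^2}{\nu\varphi}\right)^{-(\nu+1)/2};$$ its variance is finite exactly when $\nu>2$. (i) If $y_i \sim N(0,\varphi_N)$ (mean $0$ and variance $\varphi_N$) with $\varphi_N>0$, then $\sqrt n\,(Z_n-3)$ converges in distribution to $N(0,24)$ as $n\to\infty$. (ii) If $y_i \sim t(0,\varphi_T,\nu)$ with $\varphi_T>0$ and $2<\nu<\infty$, then $\sqrt n\,(Z_n-3)$ diverges as $n\to\infty$: it tends to $+\infty$ almost surely.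 If moreover $\nu>4$, then $Z_n \to \frac{3(\nu-2)}{\nu-4}$ almost surely. (iii) Case (i) is the limit $\nu\to\infty$ of case (ii): for every $\varphi>0$, $t(0,\varphi,\nu)$ converges weakly to $N(0,\varphi)$ as $\nu\to\infty$. -/

import Mathlib

open MeasureTheory ProbabilityTheory Filter Topology
open scoped NNReal ENNReal BoundedContinuousFunction

noncomputable section

/-- The mean of the first `n` terms of a sequence of observations. -/
def sampleMean (n : ℕ) (y : ℕ → ℝ) : ℝ :=
  (1 / (n : ℝ)) * ∑ i ∈ Finset.range n, y i

/-- The `k`-th central sample moment of the first `n` terms of a sequence of observations. -/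
def centralSampleMoment (k n : ℕ) (y : ℕ → ℝ) : ℝ :=
  (1 / (n : ℝ)) * ∑ i ∈ Finset.range n, (y i - sampleMean n y) ^ k

/-- The sample kurtosis of the first `n` terms of a sequence of observations. -/
def sampleKurtosis (n : ℕ) (y : ℕ → ℝ) : ℝ :=
  centralSampleMoment 4 n y / (centralSampleMoment 2 n y) ^ 2

/-- The density of the Student distribution `t(0, φ, ν)` centred at `0`, with squared scale `φ`
and `ν` degrees of freedom (its variance is `φ * ν / (ν - 2)` when `2 < ν`). -/
def studentTPDF (φ : ℝ≥0) (ν x : ℝ) : ℝ :=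
  Real.Gamma ((ν + 1) / 2) / (Real.Gamma (ν / 2) * √(ν * Real.pi * φ)) *
    (1 + x ^ 2 / (ν * φ)) ^ (-((ν + 1) / 2))

/-- The Student distribution `t(0, φ, ν)`, for `0 < φ` and `0 < ν`. -/
def studentT (φ : ℝ≥0) (ν : ℝ) : Measure ℝ :=
  volume.withDensity (fun x ↦ ENNReal.ofReal (studentTPDF φ ν x))

end

/-! Write `m k` for the central sample moments, so that the excess kurtosis is (m4 - 3 m2²) / m2².
For Gaussian data with variance v, expanding the numerator gives the sample mean of the Hermite
polynomial x⁴ - 6v x² + 3v² plus products of a centred mean with a factor tending to 0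
(`sqrt_mul_centralSampleMoment_four_sub`). After scaling by √n, the central limit theorem handles
the first term, with variance 24 v⁴, and Slutsky removes the others; dividing by m2² → v² leaves 24.

For Student data the strong law suffices. If ν > 4, the kurtosis converges to a limit above 3; if 2
< ν ≤ 4, m4 → ∞ while m2 converges. Either way the factor √n forces divergence. Gaussian and Student
moments both come from integration by parts.

The weak limit is dominated convergence of densities: log-convexity of Gamma controls the
normalizing constant, Bernoulli's inequality gives a dominating function independent of ν. -/

/-! ### Slutsky-type tools. -/

section Convergence

variable {Ω Λ : Type*} [MeasurableSpace Ω] [MeasurableSpace Λ] {P : Measure Ω}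
  [IsProbabilityMeasure P] {Q : Measure Λ} [IsProbabilityMeasure Q]

/-- Convergence in distribution to a constant implies convergence in probability. -/
theorem tendstoInMeasure_of_tendstoInDistribution_const {X : ℕ → Ω → ℝ} {c : ℝ}
    (h : TendstoInDistribution X atTop (fun _ : Λ ↦ c) (fun _ ↦ P) Q) :
    TendstoInMeasure P X atTop (fun _ ↦ c) := by
  rw [tendstoInMeasure_iff_norm]
  intro ε hε
  have hclosed : IsClosed {x : ℝ | ε ≤ ‖x - c‖} :=
    isClosed_le continuous_const (by fun_prop)
  have hlim := ProbabilityMeasure.limsup_measure_closed_le_of_tendsto h.tendsto hclosed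
  have hmap : ∀ n, (P.map (X n)) {x : ℝ | ε ≤ ‖x - c‖} = P {ω | ε ≤ ‖X n ω - c‖} := fun n ↦
    Measure.map_apply_of_aemeasurable (h.forall_aemeasurable n) hclosed.measurableSet
  have hzero : (Q.map (fun _ : Λ ↦ c)) {x : ℝ | ε ≤ ‖x - c‖} = 0 := by
    rw [Measure.map_apply (by fun_prop) hclosed.measurableSet]
    simp [not_le.2 hε]
  simp only [ProbabilityMeasure.coe_mk, hmap, hzero] at hlim
  exact tendsto_of_le_liminf_of_limsup_le (by simp) hlim

/-- The product of a sequence converging in distribution and of a sequence converging almost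
surely to zero converges to zero in probability. -/
theorem TendstoInDistribution.tendstoInMeasure_mul_zero {X B : ℕ → Ω → ℝ} {Z : Λ → ℝ}
    (h : TendstoInDistribution X atTop Z (fun _ ↦ P) Q) (hB : ∀ n, AEMeasurable (B n) P)
    (hB0 : ∀ᵐ ω ∂P, Tendsto (fun n ↦ B n ω) atTop (𝓝 0)) :
    TendstoInMeasure P (fun n ω ↦ X n ω * B n ω) atTop (fun _ ↦ 0) := by
  have hBm : TendstoInMeasure P B atTop (fun _ ↦ 0) :=
    tendstoInMeasure_of_tendsto_ae (fun n ↦ (hB n).aestronglyMeasurable) hB0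
  have := h.continuous_comp_prodMk_of_tendstoInMeasure_const (g := fun x : ℝ × ℝ ↦ x.1 * x.2)
    (by fun_prop) hBm hB
  simp only [mul_zero] at this
  exact tendstoInMeasure_of_tendstoInDistribution_const this

/-- Only the law of the limit matters; this replaces the composite limit variable that Slutsky
produces by `id`. -/
theorem tendstoInDistribution_of_map_eq {Ω₁ Ω₂ Ω₃ : Type*} [MeasurableSpace Ω₁]
    [MeasurableSpace Ω₂] [MeasurableSpace Ω₃] {P₁ : Measure Ω₁} {P₂ : Measure Ω₂} {P₃ : Measure Ω₃}
    [IsProbabilityMeasure P₁] [IsProbabilityMeasure P₂] [IsProbabilityMeasure P₃]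
    {X : ℕ → Ω₁ → ℝ} {Z : Ω₂ → ℝ} {T : Ω₃ → ℝ}
    (h : TendstoInDistribution X atTop Z (fun _ ↦ P₁) P₂) (hT : AEMeasurable T P₃)
    (hZT : P₂.map Z = P₃.map T) : TendstoInDistribution X atTop T (fun _ ↦ P₁) P₃ where
  forall_aemeasurable := h.forall_aemeasurable
  aemeasurable_limit := hT
  tendsto := by
    have := h.tendsto
    simp only [hZT] at this
    exact this

end Convergence

/-! ### Laws of large numbers and central limit theorem for functions of the observations. -/

section Sampling

variable {Ω : Type*} [MeasurableSpace Ω] {P : Measure Ω}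
  {y : ℕ → Ω → ℝ} {μ : Measure ℝ}

theorem tendsto_sum_div_ae (hindep : iIndepFun y P) (hy : ∀ τ, HasLaw (y τ) μ P) {g : ℝ → ℝ}
    (hg : Measurable g) (hgi : Integrable g μ) :
    ∀ᵐ ω ∂P, Tendsto (fun n : ℕ ↦ (∑ i ∈ Finset.range n, g (y i ω)) / n) atTop
      (𝓝 (∫ x, g x ∂μ)) := by
  have hint : Integrable (g ∘ y 0) P := by
    rw [← (hy 0).map_eq] at hgi
    exact hgi.comp_aemeasurable (hy 0).aemeasurable
  have := strong_law_ae_real (fun i ↦ g ∘ y i) hint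
    (fun i j hij ↦ (hindep.indepFun hij).comp hg hg)
    (fun i ↦ ((hy i).identDistrib (hy 0)).comp hg)
  rwa [(hy 0).integral_comp hg.aestronglyMeasurable] at this

variable [IsProbabilityMeasure P]

/-- The strong law of large numbers for nonnegative functions with infinite mean. -/
theorem tendsto_sum_div_atTop_ae (hindep : iIndepFun y P) (hy : ∀ τ, HasLaw (y τ) μ P)
    {g : ℝ → ℝ} (hg : Measurable g) (hg0 : ∀ x, 0 ≤ g x) (hgi : ¬ Integrable g μ) :
    ∀ᵐ ω ∂P, Tendsto (fun n : ℕ ↦ (∑ i ∈ Finset.range n, g (y i ω)) / n) atTop atTop := by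
  have : IsProbabilityMeasure μ := (hy 0).isProbabilityMeasure_iff.1 inferInstance
  have htrunc : ∀ K : ℕ, Integrable (fun x ↦ min (g x) K) μ := fun K ↦
    Integrable.of_bound (by fun_prop) (K : ℝ) (ae_of_all _ fun x ↦ by
      rw [Real.norm_of_nonneg (le_min (hg0 x) (Nat.cast_nonneg _))]
      exact min_le_right _ _)
  -- Were the truncated means bounded, monotone convergence would make `g` integrable.
  have hunb : ∀ C : ℕ, ∃ K : ℕ, (C : ℝ) < ∫ x, min (g x) K ∂μ := by
    intro C
    by_contra! hC
    apply hgi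
    refine ⟨hg.aestronglyMeasurable, ?_⟩
    rw [hasFiniteIntegral_iff_ofReal (ae_of_all _ hg0)]
    have hlim : Tendsto (fun K : ℕ ↦ ∫⁻ x, ENNReal.ofReal (min (g x) K) ∂μ) atTop
        (𝓝 (∫⁻ x, ENNReal.ofReal (g x) ∂μ)) := by
      refine lintegral_tendsto_of_tendsto_of_monotone (fun K ↦ by fun_prop)
        (ae_of_all _ fun x i j hij ↦ ?_) (ae_of_all _ fun x ↦ ?_)
      · have : (i : ℝ) ≤ j := by exact_mod_cast hij
        dsimp only
        gcongr
      · refine tendsto_const_nhds.congr' ?_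
        filter_upwards [tendsto_natCast_atTop_atTop.eventually_ge_atTop (g x)] with K hK
        rw [min_eq_left hK]
    refine (le_of_tendsto' hlim fun K ↦ ?_).trans_lt (ENNReal.ofReal_lt_top (r := C))
    rw [← ofReal_integral_eq_lintegral_ofReal (htrunc K)
      (ae_of_all _ fun x ↦ le_min (hg0 x) (Nat.cast_nonneg _))]
    exact ENNReal.ofReal_le_ofReal (hC K)
  -- Truncation levels are natural numbers, so one null set serves them all.
  have hall : ∀ᵐ ω ∂P, ∀ K : ℕ, Tendsto
      (fun n : ℕ ↦ (∑ i ∈ Finset.range n, min (g (y i ω)) K) / n) atTop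
      (𝓝 (∫ x, min (g x) K ∂μ)) :=
    ae_all_iff.2 fun K ↦ tendsto_sum_div_ae hindep hy (by fun_prop) (htrunc K)
  filter_upwards [hall] with ω hω
  refine tendsto_atTop.2 fun b ↦ ?_
  obtain ⟨C, hC⟩ := exists_nat_gt b
  obtain ⟨K, hK⟩ := hunb C
  filter_upwards [(hω K).eventually_const_lt (hC.trans hK)] with n hn
  refine hn.le.trans ?_
  gcongr
  exact min_le_left _ _

theorem tendstoInDistribution_sqrt_mul_mean_sub (hindep : iIndepFun y P)
    (hy : ∀ τ, HasLaw (y τ) μ P) {g : ℝ → ℝ} (hg : Measurable g) (hg2 : MemLp g 2 μ) :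
    TendstoInDistribution
      (fun (n : ℕ) ω ↦ √(n : ℝ) * ((∑ i ∈ Finset.range n, g (y i ω)) / n - ∫ x, g x ∂μ))
      atTop (id : ℝ → ℝ) (fun _ ↦ P) (gaussianReal 0 Var[g; μ].toNNReal) := by
  have hvar : Var[g ∘ y 0; P] = Var[g; μ] := by
    rw [← (hy 0).map_eq, variance_map (by fun_prop) (hy 0).aemeasurable]
  have hmem : MemLp (g ∘ y 0) 2 P := by
    rw [← (hy 0).map_eq] at hg2
    exact (memLp_map_measure_iff hg.aestronglyMeasurable (hy 0).aemeasurable).1 hg2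
  have := tendstoInDistribution_inv_sqrt_mul_sum_sub (P := P) (X := fun i ↦ g ∘ y i)
    (Y := (id : ℝ → ℝ)) (P' := gaussianReal 0 Var[g; μ].toNNReal)
    (by rw [hvar]; exact HasLaw.id) hmem (hindep.comp (fun _ ↦ g) (fun _ ↦ hg))
    (fun i ↦ ((hy i).identDistrib (hy 0)).comp hg)
  rw [(hy 0).integral_comp hg.aestronglyMeasurable] at this
  convert this using 3 with n ω
  rcases Nat.eq_zero_or_pos n with rfl | hn
  · simp
  · have hn' : (0 : ℝ) < n := by exact_mod_cast hn
    have hs : √(n : ℝ) ≠ 0 := (Real.sqrt_pos.2 hn').ne'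
    have hss : √(n : ℝ) ^ 2 = n := Real.sq_sqrt hn'.le
    simp only [Function.comp]
    field_simp
    rw [hss]

end Sampling

/-! ### Central sample moments in terms of raw ones. -/

section SampleMoments

theorem sampleMean_eq_div (n : ℕ) (y : ℕ → ℝ) :
    sampleMean n y = (∑ i ∈ Finset.range n, y i) / n := by
  rw [sampleMean, one_div_mul_eq_div]

theorem centralSampleMoment_two (n : ℕ) (y : ℕ → ℝ) :
    centralSampleMoment 2 n y =
      (∑ i ∈ Finset.range n, y i ^ 2) / n - ((∑ i ∈ Finset.range n, y i) / n) ^ 2 := by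
  rw [centralSampleMoment, sampleMean_eq_div]
  rcases eq_or_ne (n : ℝ) 0 with hn | hn
  · simp [hn]
  set a := (∑ i ∈ Finset.range n, y i) / (n : ℝ) with ha
  have h1 : ∑ i ∈ Finset.range n, y i = n * a := by rw [ha]; field_simp
  have h : ∀ i, (y i - a) ^ 2 = y i ^ 2 - 2 * a * y i + a ^ 2 := fun i ↦ by ring
  simp_rw [h, Finset.sum_add_distrib, Finset.sum_sub_distrib, ← Finset.mul_sum, h1]
  simp only [Finset.sum_const, Finset.card_range, nsmul_eq_mul]
  field_simp
  ring

theorem centralSampleMoment_four (n : ℕ) (y : ℕ → ℝ) :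
    centralSampleMoment 4 n y =
      (∑ i ∈ Finset.range n, y i ^ 4) / n
        - 4 * ((∑ i ∈ Finset.range n, y i) / n) * ((∑ i ∈ Finset.range n, y i ^ 3) / n)
        + 6 * ((∑ i ∈ Finset.range n, y i) / n) ^ 2 * ((∑ i ∈ Finset.range n, y i ^ 2) / n)
        - 3 * ((∑ i ∈ Finset.range n, y i) / n) ^ 4 := by
  rw [centralSampleMoment, sampleMean_eq_div]
  rcases eq_or_ne (n : ℝ) 0 with hn | hn
  · simp [hn]
  set a := (∑ i ∈ Finset.range n, y i) / (n : ℝ) with ha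
  have h1 : ∑ i ∈ Finset.range n, y i = n * a := by rw [ha]; field_simp
  have h : ∀ i, (y i - a) ^ 4 =
      y i ^ 4 - 4 * a * y i ^ 3 + 6 * a ^ 2 * y i ^ 2 - 4 * a ^ 3 * y i + a ^ 4 := fun i ↦ by ring
  simp_rw [h, Finset.sum_add_distrib, Finset.sum_sub_distrib, Finset.sum_add_distrib,
    Finset.sum_sub_distrib, ← Finset.mul_sum, h1]
  simp only [Finset.sum_const, Finset.card_range, nsmul_eq_mul]
  field_simp
  ring

/-- This bound avoids the third sample moment, whose mean need not exist when ν ≤ 3. -/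
theorem centralSampleMoment_four_ge (n : ℕ) (y : ℕ → ℝ) :
    (∑ i ∈ Finset.range n, y i ^ 4) / n / 8 - ((∑ i ∈ Finset.range n, y i) / n) ^ 4 ≤
      centralSampleMoment 4 n y := by
  rw [centralSampleMoment, sampleMean_eq_div]
  rcases Nat.eq_zero_or_pos n with rfl | hn
  · simp
  have hn' : (0 : ℝ) < n := by exact_mod_cast hn
  set a := (∑ i ∈ Finset.range n, y i) / (n : ℝ) with ha
  have h : ∀ i, y i ^ 4 / 8 - a ^ 4 ≤ (y i - a) ^ 4 := fun i ↦ by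
    -- Applying (u + a)² ≤ 2(u² + a²), squaring, then using the same convexity again gives the
    -- factor 2² · 2 = 8.
    have h1 : y i ^ 2 ≤ 2 * ((y i - a) ^ 2 + a ^ 2) := by nlinarith [sq_nonneg (y i - 2 * a)]
    have h2 : (y i ^ 2) ^ 2 ≤ (2 * ((y i - a) ^ 2 + a ^ 2)) ^ 2 := by gcongr
    nlinarith [sq_nonneg ((y i - a) ^ 2 - a ^ 2)]
  have hs := Finset.sum_le_sum fun i (_ : i ∈ Finset.range n) ↦ h i
  rw [Finset.sum_sub_distrib, ← Finset.sum_div] at hs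
  simp only [Finset.sum_const, Finset.card_range, nsmul_eq_mul] at hs
  rw [one_div_mul_eq_div, le_div_iff₀ hn']
  refine le_trans (le_of_eq ?_) hs
  field_simp

end SampleMoments

/-! ### Gaussian moments and the fourth Hermite polynomial. -/

section GaussianMoments

theorem integrable_pow_gaussianReal (μ : ℝ) (v : ℝ≥0) (k : ℕ) :
    Integrable (fun x ↦ x ^ k) (gaussianReal μ v) := by
  have h := (memLp_id_gaussianReal' (μ := μ) (v := v) (k : ℝ≥0∞) (by simp)).integrable_norm_pow'
  refine h.mono' (by fun_prop) (ae_of_all _ fun x ↦ ?_)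
  simp

theorem integrable_gaussianPDFReal_mul_pow {v : ℝ≥0} (hv : v ≠ 0) (k : ℕ) :
    Integrable (fun x ↦ gaussianPDFReal 0 v x * x ^ k) := by
  have h := integrable_pow_gaussianReal 0 v k
  rw [gaussianReal_of_var_ne_zero 0 hv, integrable_withDensity_iff_integrable_smul'
    (measurable_gaussianPDF 0 v) (ae_of_all _ fun _ ↦ gaussianPDF_lt_top)] at h
  simpa [toReal_gaussianPDF] using h

theorem hasDerivAt_gaussianPDFReal {v : ℝ≥0} (x : ℝ) :
    HasDerivAt (gaussianPDFReal 0 v) (gaussianPDFReal 0 v x * (-(x / v))) x := by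
  have h : HasDerivAt (fun x : ℝ ↦ -(x - 0) ^ 2 / (2 * v)) (-(x / v)) x := by
    refine (((((hasDerivAt_id x).sub_const 0).pow 2).neg).div_const (2 * (v : ℝ))).congr_deriv ?_
    rcases eq_or_ne (v : ℝ) 0 with hv | hv
    · simp [hv]
    · simp
      field_simp
  refine (h.exp.const_mul _).congr_deriv ?_
  rw [gaussianPDFReal]
  ring

/-- The derivative of density times x^(k+1) integrates to 0 over the line. -/
theorem integral_pow_add_two_gaussianReal {v : ℝ≥0} (hv : v ≠ 0) (k : ℕ) :
    ∫ x, x ^ (k + 2) ∂(gaussianReal 0 v) = (k + 1) * v * ∫ x, x ^ k ∂(gaussianReal 0 v) := by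
  have hv' : (v : ℝ) ≠ 0 := by exact_mod_cast hv
  have hd : ∀ x : ℝ, HasDerivAt (fun x ↦ gaussianPDFReal 0 v x * x ^ (k + 1))
      ((k + 1) * (gaussianPDFReal 0 v x * x ^ k)
        - (v : ℝ)⁻¹ * (gaussianPDFReal 0 v x * x ^ (k + 2))) x := fun x ↦ by
    refine ((hasDerivAt_gaussianPDFReal x).mul (hasDerivAt_pow (k + 1) x)).congr_deriv ?_
    push_cast
    field_simp
    ring
  have hk := (integrable_gaussianPDFReal_mul_pow hv k).const_mul ((k : ℝ) + 1)
  have hk2 := (integrable_gaussianPDFReal_mul_pow hv (k + 2)).const_mul (v : ℝ)⁻¹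
  have h0 := integral_eq_zero_of_hasDerivAt_of_integrable hd (hk.sub hk2)
    (integrable_gaussianPDFReal_mul_pow hv (k + 1))
  rw [integral_sub hk hk2, integral_const_mul, integral_const_mul] at h0
  simp only [integral_gaussianReal_eq_integral_smul hv, smul_eq_mul]
  field_simp at h0
  linarith

theorem integral_pow_one_gaussianReal (v : ℝ≥0) : ∫ x, x ^ 1 ∂(gaussianReal 0 v) = 0 := by
  simp [integral_id_gaussianReal]

theorem integral_pow_two_gaussianReal {v : ℝ≥0} (hv : v ≠ 0) :
    ∫ x, x ^ 2 ∂(gaussianReal 0 v) = v := by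
  simpa using integral_pow_add_two_gaussianReal hv 0

theorem integral_pow_three_gaussianReal {v : ℝ≥0} (hv : v ≠ 0) :
    ∫ x, x ^ 3 ∂(gaussianReal 0 v) = 0 := by
  simpa [integral_id_gaussianReal] using integral_pow_add_two_gaussianReal hv 1

theorem integral_pow_four_gaussianReal {v : ℝ≥0} (hv : v ≠ 0) :
    ∫ x, x ^ 4 ∂(gaussianReal 0 v) = 3 * v ^ 2 := by
  rw [integral_pow_add_two_gaussianReal hv 2, integral_pow_two_gaussianReal hv]
  push_cast
  ring

theorem integral_pow_six_gaussianReal {v : ℝ≥0} (hv : v ≠ 0) :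
    ∫ x, x ^ 6 ∂(gaussianReal 0 v) = 15 * v ^ 3 := by
  rw [integral_pow_add_two_gaussianReal hv 4, integral_pow_four_gaussianReal hv]
  push_cast
  ring

theorem integral_pow_eight_gaussianReal {v : ℝ≥0} (hv : v ≠ 0) :
    ∫ x, x ^ 8 ∂(gaussianReal 0 v) = 105 * v ^ 4 := by
  rw [integral_pow_add_two_gaussianReal hv 6, integral_pow_six_gaussianReal hv]
  push_cast
  ring

/-- The fourth Hermite polynomial for the variance `v`. -/
noncomputable def hermiteFour (v : ℝ≥0) (x : ℝ) : ℝ := x ^ 4 - 6 * v * x ^ 2 + 3 * v ^ 2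

@[fun_prop]
theorem measurable_hermiteFour (v : ℝ≥0) : Measurable (hermiteFour v) := by
  unfold hermiteFour
  fun_prop

theorem integral_hermiteFour_gaussianReal {v : ℝ≥0} (hv : v ≠ 0) :
    ∫ x, hermiteFour v x ∂(gaussianReal 0 v) = 0 := by
  have I := fun k ↦ integrable_pow_gaussianReal 0 v k
  simp only [hermiteFour]
  have I42 : Integrable (fun x : ℝ ↦ x ^ 4 - 6 * v * x ^ 2) (gaussianReal 0 v) :=
    (I 4).sub ((I 2).const_mul _)
  rw [integral_add I42 (integrable_const _),
    integral_sub (I 4) ((I 2).const_mul _), integral_const_mul,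
    integral_pow_four_gaussianReal hv, integral_pow_two_gaussianReal hv]
  simp
  ring

theorem hermiteFour_sq (v : ℝ≥0) (x : ℝ) : hermiteFour v x ^ 2 =
    x ^ 8 + (-12 * v) * x ^ 6 + 42 * v ^ 2 * x ^ 4 + (-36 * v ^ 3) * x ^ 2 + 9 * v ^ 4 := by
  rw [hermiteFour]
  ring

theorem memLp_two_hermiteFour_gaussianReal (v : ℝ≥0) :
    MemLp (hermiteFour v) 2 (gaussianReal 0 v) := by
  have I := fun k ↦ integrable_pow_gaussianReal 0 v k
  rw [memLp_two_iff_integrable_sq (by fun_prop)]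
  simp_rw [hermiteFour_sq]
  exact ((((I 8).fun_add ((I 6).const_mul _)).fun_add ((I 4).const_mul _)).fun_add ((I 2).const_mul _)).add
    (integrable_const _)

/-- In units of v⁴ the even moments give 105 - 180 + 126 - 36 + 9 = 24. -/
theorem variance_hermiteFour_gaussianReal {v : ℝ≥0} (hv : v ≠ 0) :
    Var[hermiteFour v; gaussianReal 0 v] = 24 * v ^ 4 := by
  have I := fun k ↦ integrable_pow_gaussianReal 0 v k
  rw [variance_of_integral_eq_zero (by fun_prop) (integral_hermiteFour_gaussianReal hv)]
  simp_rw [hermiteFour_sq]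
  rw [integral_add ((((I 8).fun_add ((I 6).const_mul _)).fun_add ((I 4).const_mul _)).fun_add
      ((I 2).const_mul _)) (integrable_const _),
    integral_add (((I 8).fun_add ((I 6).const_mul _)).fun_add ((I 4).const_mul _)) ((I 2).const_mul _),
    integral_add ((I 8).fun_add ((I 6).const_mul _)) ((I 4).const_mul _),
    integral_add (I 8) ((I 6).const_mul _)]
  simp only [integral_const_mul, integral_pow_eight_gaussianReal hv,
    integral_pow_six_gaussianReal hv, integral_pow_four_gaussianReal hv,
    integral_pow_two_gaussianReal hv]
  simp
  ring

end GaussianMoments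

/-! ### Asymptotic normality for Gaussian data. -/

section GaussianKurtosis

variable {Ω : Type*} [MeasurableSpace Ω] {P : Measure Ω} {y : ℕ → Ω → ℝ}

theorem aemeasurable_sampleKurtosis (hy : ∀ τ, AEMeasurable (y τ) P) (n : ℕ) :
    AEMeasurable (fun ω ↦ sampleKurtosis n (fun τ ↦ y τ ω)) P := by
  simp only [sampleKurtosis, centralSampleMoment, sampleMean]
  fun_prop

/-- Expansion of the numerator of the excess sample kurtosis around the variance `v`. -/
theorem sqrt_mul_centralSampleMoment_four_sub (v : ℝ≥0) {n : ℕ} (hn : n ≠ 0) (y : ℕ → ℝ) :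
    √(n : ℝ) * (centralSampleMoment 4 n y - 3 * centralSampleMoment 2 n y ^ 2) =
      √(n : ℝ) * ((∑ i ∈ Finset.range n, hermiteFour v (y i)) / n)
      + √(n : ℝ) * ((∑ i ∈ Finset.range n, y i ^ 2) / n - v) *
          (-3 * ((∑ i ∈ Finset.range n, y i ^ 2) / n - v))
      + √(n : ℝ) * ((∑ i ∈ Finset.range n, y i) / n) *
          (-4 * ((∑ i ∈ Finset.range n, y i ^ 3) / n)
            + 12 * ((∑ i ∈ Finset.range n, y i) / n) * ((∑ i ∈ Finset.range n, y i ^ 2) / n)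
            - 6 * ((∑ i ∈ Finset.range n, y i) / n) ^ 3) := by
  have hn' : (n : ℝ) ≠ 0 := by exact_mod_cast hn
  have hH : (∑ i ∈ Finset.range n, hermiteFour v (y i)) / n =
      (∑ i ∈ Finset.range n, y i ^ 4) / n - 6 * v * ((∑ i ∈ Finset.range n, y i ^ 2) / n)
        + 3 * v ^ 2 := by
    simp only [hermiteFour, Finset.sum_add_distrib, Finset.sum_sub_distrib, ← Finset.mul_sum,
      Finset.sum_const, Finset.card_range, nsmul_eq_mul]
    field_simp
  rw [centralSampleMoment_two, centralSampleMoment_four, hH]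
  ring

theorem tendstoInDistribution_sqrt_mul_sampleKurtosis_gaussian [IsProbabilityMeasure P]
    (hindep : iIndepFun y P) {v : ℝ≥0} (hv : v ≠ 0) (hy : ∀ τ, HasLaw (y τ) (gaussianReal 0 v) P) :
    TendstoInDistribution
      (fun (n : ℕ) (ω : Ω) ↦ √(n : ℝ) * (sampleKurtosis n (fun τ ↦ y τ ω) - 3))
      atTop (id : ℝ → ℝ) (fun _ ↦ P) (gaussianReal 0 24) := by
  have hv' : (v : ℝ) ≠ 0 := by exact_mod_cast hv
  have hym : ∀ τ, AEMeasurable (y τ) P := fun τ ↦ (hy τ).aemeasurable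
  let M (k n : ℕ) (ω : Ω) : ℝ := (∑ i ∈ Finset.range n, y i ω ^ k) / n
  have hMm : ∀ k n, AEMeasurable (M k n) P := fun k n ↦ by fun_prop
  have hM : ∀ k, ∀ᵐ ω ∂P, Tendsto (fun n ↦ M k n ω) atTop (𝓝 (∫ x, x ^ k ∂(gaussianReal 0 v))) :=
    fun k ↦ tendsto_sum_div_ae hindep hy (measurable_id.pow_const k)
      (integrable_pow_gaussianReal 0 v k)
  have hM1 := hM 1
  have hM2 := hM 2
  have hM3 := hM 3
  rw [integral_pow_one_gaussianReal] at hM1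
  rw [integral_pow_two_gaussianReal hv] at hM2
  rw [integral_pow_three_gaussianReal hv] at hM3
  have hpow : ∀ k, MemLp (fun x : ℝ ↦ x ^ k) 2 (gaussianReal 0 v) := fun k ↦ by
    rw [memLp_two_iff_integrable_sq (by fun_prop)]
    simpa only [← pow_mul] using integrable_pow_gaussianReal 0 v (k * 2)
  have hclt : ∀ k, TendstoInDistribution
      (fun (n : ℕ) ω ↦ √(n : ℝ) * (M k n ω - ∫ x, x ^ k ∂(gaussianReal 0 v))) atTop (id : ℝ → ℝ)
      (fun _ ↦ P) _ := fun k ↦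
    tendstoInDistribution_sqrt_mul_mean_sub hindep hy (measurable_id.pow_const k) (hpow k)
  have hclt1 := hclt 1
  have hclt2 := hclt 2
  rw [integral_pow_one_gaussianReal] at hclt1
  rw [integral_pow_two_gaussianReal hv] at hclt2
  -- Both remainders are a √n-scaled mean, convergent in law, times a factor tending to 0 almost
  -- surely.
  have hR2 := TendstoInDistribution.tendstoInMeasure_mul_zero hclt2
    (B := fun n ω ↦ -3 * (M 2 n ω - v)) (fun n ↦ by fun_prop) (by
      filter_upwards [hM2] with ω h2
      simpa using (h2.sub_const (v : ℝ)).const_mul (-3))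
  have hR1 := TendstoInDistribution.tendstoInMeasure_mul_zero hclt1
    (B := fun n ω ↦ -4 * M 3 n ω + 12 * M 1 n ω * M 2 n ω - 6 * M 1 n ω ^ 3)
    (fun n ↦ by fun_prop) (by
      filter_upwards [hM1, hM2, hM3] with ω h1 h2 h3
      simpa using ((h3.const_mul (-4)).add ((h1.const_mul 12).mul h2)).sub
        ((h1.pow 3).const_mul 6))
  have hmain := tendstoInDistribution_sqrt_mul_mean_sub hindep hy (measurable_hermiteFour v)
    (memLp_two_hermiteFour_gaussianReal v)
  rw [integral_hermiteFour_gaussianReal hv, variance_hermiteFour_gaussianReal hv] at hmain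
  have hnum := (hmain.add_of_tendstoInMeasure_const hR2 (fun n ↦ by fun_prop)
    ).add_of_tendstoInMeasure_const hR1 (fun n ↦ by fun_prop)
  have hden : ∀ᵐ ω ∂P, Tendsto (fun n ↦ M 2 n ω - M 1 n ω ^ 2) atTop (𝓝 (v : ℝ)) := by
    filter_upwards [hM1, hM2] with ω h1 h2
    simpa using h2.sub (h1.pow 2)
  have hinv : TendstoInMeasure P (fun n ω ↦ ((M 2 n ω - M 1 n ω ^ 2) ^ 2)⁻¹) atTop
      (fun _ ↦ ((v : ℝ) ^ 2)⁻¹) := by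
    refine tendstoInMeasure_of_tendsto_ae (fun n ↦ by
      exact AEMeasurable.aestronglyMeasurable (by fun_prop)) ?_
    filter_upwards [hden] with ω h
    exact (h.pow 2).inv₀ (pow_ne_zero 2 hv')
  have hquot := hnum.continuous_comp_prodMk_of_tendstoInMeasure_const
    (g := fun x : ℝ × ℝ ↦ x.1 * x.2) (by fun_prop) hinv (fun n ↦ by fun_prop)
  have hlaw : (gaussianReal 0 (24 * (v : ℝ) ^ 4).toNNReal).map
      (fun ω : ℝ ↦ (id ω + 0 + 0) * ((v : ℝ) ^ 2)⁻¹) = (gaussianReal 0 24).map id := by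
    simp only [id_eq, add_zero, Measure.map_id]
    rw [gaussianReal_map_mul_const, mul_zero]
    congr 1
    ext
    have : (0 : ℝ) ≤ 24 * (v : ℝ) ^ 4 := by positivity
    simp [Real.coe_toNNReal _ this]
    field_simp
  -- The statistic and the quotient agree once n ≠ 0 and m2 ≠ 0, hence eventually, almost surely,
  -- because m2 → v ≠ 0.
  refine tendstoInDistribution_of_tendstoInMeasure_sub _ _
    (tendstoInDistribution_of_map_eq hquot aemeasurable_id hlaw) ?_
    (fun n ↦ ((aemeasurable_sampleKurtosis hym n).sub_const 3).const_mul _)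
  refine tendstoInMeasure_of_tendsto_ae (fun n ↦ ?_) ?_
  · have := aemeasurable_sampleKurtosis hym n
    exact AEMeasurable.aestronglyMeasurable (by
      simp only [Pi.sub_def, Pi.add_def]
      fun_prop)
  filter_upwards [hden] with ω hω
  refine tendsto_const_nhds.congr' ?_
  filter_upwards [hω.eventually_ne hv', eventually_ne_atTop 0] with n hne hn
  have hexp := sqrt_mul_centralSampleMoment_four_sub v hn (fun τ ↦ y τ ω)
  have h2 : centralSampleMoment 2 n (fun τ ↦ y τ ω) = M 2 n ω - M 1 n ω ^ 2 := by
    rw [centralSampleMoment_two]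
    simp [M]
  rw [← h2] at hne
  simp only [Pi.sub_apply, Pi.add_apply, Pi.zero_apply, sub_zero, ← h2]
  rw [eq_comm, sub_eq_zero]
  have hM1' : M 1 n ω = (∑ i ∈ Finset.range n, y i ω) / n := by simp [M]
  simp only [hM1', M]
  rw [← hexp, sampleKurtosis]
  field_simp

end GaussianKurtosis

/-! ### Powers integrated against (1 + x²/c)^r. -/

section StudentKernel

variable {c r : ℝ}

theorem one_add_sq_div_pos (hc : 0 < c) (x : ℝ) : 0 < 1 + x ^ 2 / c := by positivity

theorem continuous_one_add_sq_div_rpow (hc : 0 < c) (r : ℝ) :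
    Continuous fun x : ℝ ↦ (1 + x ^ 2 / c) ^ r :=
  (by fun_prop : Continuous fun x : ℝ ↦ 1 + x ^ 2 / c).rpow_const
    fun x ↦ .inl (one_add_sq_div_pos hc x).ne'

/-- Since x² ≤ c(1 + x²/c), a power of x only shifts the exponent of the kernel. -/
theorem abs_pow_mul_one_add_sq_div_rpow_le (hc : 0 < c) (r : ℝ) (k : ℕ) (x : ℝ) :
    |x ^ k * (1 + x ^ 2 / c) ^ r| ≤ c ^ (k / 2 : ℝ) * (1 + x ^ 2 / c) ^ (k / 2 + r : ℝ) := by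
  have hp := one_add_sq_div_pos hc x
  have hx : |x ^ k| = (x ^ 2) ^ (k / 2 : ℝ) := by
    rw [abs_pow, ← sq_abs x, ← Real.rpow_natCast |x| 2, ← Real.rpow_mul (abs_nonneg x),
      ← Real.rpow_natCast]
    congr 1
    push_cast
    ring
  rw [abs_mul, hx, abs_of_nonneg (Real.rpow_nonneg hp.le r), Real.rpow_add hp, ← mul_assoc,
    ← Real.mul_rpow hc.le hp.le]
  gcongr
  have : c * (1 + x ^ 2 / c) = c + x ^ 2 := by field_simp
  linarith

theorem integrable_one_add_sq_div_rpow (hc : 0 < c) (hr : r < -(1 / 2)) :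
    Integrable fun x : ℝ ↦ (1 + x ^ 2 / c) ^ r := by
  have h := (integrable_rpow_neg_one_add_norm_sq (E := ℝ) (μ := volume) (r := -2 * r)
    (by simp; linarith)).comp_div (Real.sqrt_pos.2 hc).ne'
  refine h.congr (ae_of_all _ fun x ↦ ?_)
  simp only [Real.norm_eq_abs, sq_abs, div_pow, Real.sq_sqrt hc.le]
  congr 1
  ring

theorem integrable_pow_mul_one_add_sq_div_rpow (hc : 0 < c) {k : ℕ} (hr : k / 2 + r < -(1 / 2)) :
    Integrable fun x : ℝ ↦ x ^ k * (1 + x ^ 2 / c) ^ r := by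
  refine ((integrable_one_add_sq_div_rpow hc hr).const_mul (c ^ (k / 2 : ℝ))).mono'
    (((continuous_pow k).mul (continuous_one_add_sq_div_rpow hc r)).aestronglyMeasurable)
    (ae_of_all _ fun x ↦ ?_)
  exact abs_pow_mul_one_add_sq_div_rpow_le hc r k x

theorem tendsto_pow_mul_one_add_sq_div_rpow_cocompact (hc : 0 < c) {k : ℕ} (hr : k / 2 + r < 0) :
    Tendsto (fun x : ℝ ↦ x ^ k * (1 + x ^ 2 / c) ^ r) (cocompact ℝ) (𝓝 0) := by
  have hsq : Tendsto (fun x : ℝ ↦ 1 + x ^ 2 / c) (cocompact ℝ) atTop := by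
    refine tendsto_atTop_add_const_left _ _ (Tendsto.atTop_div_const hc ?_)
    have := (tendsto_pow_atTop (α := ℝ) two_ne_zero).comp (tendsto_norm_cocompact_atTop (E := ℝ))
    simpa [Function.comp_def] using this
  have hz : Tendsto (fun x : ℝ ↦ c ^ (k / 2 : ℝ) * (1 + x ^ 2 / c) ^ (k / 2 + r : ℝ))
      (cocompact ℝ) (𝓝 0) := by
    have := ((tendsto_rpow_neg_atTop (neg_pos.2 hr)).comp hsq).const_mul (c ^ (k / 2 : ℝ))
    simpa only [neg_neg, mul_zero, Function.comp_def] using this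
  exact squeeze_zero_norm (fun x ↦ abs_pow_mul_one_add_sq_div_rpow_le hc r k x) hz

/-- Integrate the derivative of x^(k+1) (1 + x²/c)^(1-s). The exponent 1 - s makes that derivative a
combination of the two integrands, and k + 3 < 2s gives both integrability and vanishing boundary
terms. -/
theorem integral_pow_add_two_mul_one_add_sq_div_rpow (hc : 0 < c) {s : ℝ} {k : ℕ}
    (hs : k + 3 < 2 * s) :
    (2 * s - 3 - k) * ∫ x : ℝ, x ^ (k + 2) * (1 + x ^ 2 / c) ^ (-s) =
      (k + 1) * c * ∫ x : ℝ, x ^ k * (1 + x ^ 2 / c) ^ (-s) := by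
  have hd : ∀ x : ℝ, HasDerivAt (fun x ↦ x ^ (k + 1) * (1 + x ^ 2 / c) ^ (1 - s))
      ((k + 1) * (x ^ k * (1 + x ^ 2 / c) ^ (-s))
        - (2 * s - 3 - k) / c * (x ^ (k + 2) * (1 + x ^ 2 / c) ^ (-s))) x := fun x ↦ by
    have hp := one_add_sq_div_pos hc x
    have h1 : HasDerivAt (fun x : ℝ ↦ 1 + x ^ 2 / c) (2 * x / c) x := by
      simpa using ((hasDerivAt_pow 2 x).div_const c).const_add 1
    refine ((hasDerivAt_pow (k + 1) x).mul
      (h1.rpow_const (p := 1 - s) (.inl hp.ne'))).congr_deriv ?_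
    have e1 : (1 - s - 1 : ℝ) = -s := by ring
    have e2 : (1 + x ^ 2 / c) ^ (1 - s) = (1 + x ^ 2 / c) * (1 + x ^ 2 / c) ^ (-s) := by
      rw [sub_eq_add_neg, Real.rpow_add hp, Real.rpow_one]
    rw [e1, e2]
    push_cast
    field_simp
    ring
  have hI0 : Integrable fun x : ℝ ↦ x ^ k * (1 + x ^ 2 / c) ^ (-s) :=
    integrable_pow_mul_one_add_sq_div_rpow hc (by linarith)
  have hI2 : Integrable fun x : ℝ ↦ x ^ (k + 2) * (1 + x ^ 2 / c) ^ (-s) :=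
    integrable_pow_mul_one_add_sq_div_rpow hc (by push_cast; linarith)
  have hlim := tendsto_pow_mul_one_add_sq_div_rpow_cocompact hc (k := k + 1) (r := 1 - s)
    (by push_cast; linarith)
  have h0 := integral_of_hasDerivAt_of_tendsto hd
    ((hI0.const_mul _).sub (hI2.const_mul _)) (hlim.mono_left atBot_le_cocompact)
    (hlim.mono_left atTop_le_cocompact)
  rw [integral_sub (hI0.const_mul _) (hI2.const_mul _), integral_const_mul, integral_const_mul,
    sub_zero, sub_eq_zero] at h0
  rw [div_mul_eq_mul_div, eq_div_iff hc.ne'] at h0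
  linarith

/-- Oddness suffices for every `c` and `r`: a divergent integral has value 0 by convention. -/
theorem integral_mul_one_add_sq_div_rpow (c r : ℝ) :
    ∫ x : ℝ, x * (1 + x ^ 2 / c) ^ r = 0 := by
  have h := integral_neg_eq_self (fun x : ℝ ↦ x * (1 + x ^ 2 / c) ^ r) volume
  simp only [neg_sq, neg_mul, integral_neg] at h
  linarith

/-- For x > 1, 1 + x²/c ≤ (1 + 1/c) x², so the integrand dominates a multiple of x^(k-2s), whose
exponent is at least -1. -/
theorem not_integrable_pow_mul_one_add_sq_div_rpow (hc : 0 < c) {k : ℕ} {s : ℝ} (hs0 : 0 ≤ s)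
    (hs : 2 * s ≤ k + 1) : ¬ Integrable fun x : ℝ ↦ x ^ k * (1 + x ^ 2 / c) ^ (-s) := by
  intro h
  have hC : 0 < (1 + 1 / c) ^ (-s) := by positivity
  have hIoi : IntegrableOn (fun x : ℝ ↦ x ^ (k - 2 * s)) (Set.Ioi 1) := by
    refine ((h.integrableOn (s := Set.Ioi 1)).const_mul ((1 + 1 / c) ^ (-s))⁻¹).mono'
      (by fun_prop) ?_
    filter_upwards [ae_restrict_mem measurableSet_Ioi] with x hx
    have hx1 : (1 : ℝ) < x := hx
    have hx0 : 0 < x := by linarith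
    rw [Real.norm_of_nonneg (by positivity), ← div_eq_inv_mul, le_div_iff₀ hC, Real.rpow_sub hx0,
      Real.rpow_natCast, Real.rpow_mul hx0.le, Real.rpow_two, div_eq_mul_inv, mul_assoc,
      ← Real.rpow_neg (by positivity), ← Real.mul_rpow (by positivity) (by positivity)]
    refine mul_le_mul_of_nonneg_left ?_ (by positivity)
    refine Real.rpow_le_rpow_of_nonpos (by positivity) ?_ (by linarith)
    have h1 : x ^ 2 * (1 + 1 / c) = x ^ 2 + x ^ 2 / c := by ring
    rw [h1]
    nlinarith
  have := (integrableOn_Ioi_rpow_iff one_pos).1 hIoi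
  linarith

end StudentKernel

/-! ### Student moments. -/

section StudentMoments

variable {φ : ℝ≥0} {ν : ℝ}

theorem studentTPDF_nonneg (hν : 0 < ν) (φ : ℝ≥0) (x : ℝ) : 0 ≤ studentTPDF φ ν x := by
  have h1 : 0 < Real.Gamma ((ν + 1) / 2) := Real.Gamma_pos_of_pos (by linarith)
  have h2 : 0 < Real.Gamma (ν / 2) := Real.Gamma_pos_of_pos (by linarith)
  unfold studentTPDF
  positivity

theorem measurable_studentTPDF (φ : ℝ≥0) (ν : ℝ) : Measurable (studentTPDF φ ν) := by
  unfold studentTPDF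
  fun_prop

theorem integral_studentT (hν : 0 < ν) (φ : ℝ≥0) (f : ℝ → ℝ) :
    ∫ x, f x ∂(studentT φ ν) = ∫ x, studentTPDF φ ν x * f x := by
  rw [studentT, integral_withDensity_eq_integral_toReal_smul
    (measurable_studentTPDF φ ν).ennreal_ofReal (ae_of_all _ fun _ ↦ ENNReal.ofReal_lt_top)]
  simp [ENNReal.toReal_ofReal (studentTPDF_nonneg hν φ _)]

theorem integrable_studentT_iff (hν : 0 < ν) (φ : ℝ≥0) (f : ℝ → ℝ) :
    Integrable f (studentT φ ν) ↔ Integrable fun x ↦ studentTPDF φ ν x * f x := by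
  rw [studentT, integrable_withDensity_iff_integrable_smul'
    (measurable_studentTPDF φ ν).ennreal_ofReal (ae_of_all _ fun _ ↦ ENNReal.ofReal_lt_top)]
  simp [ENNReal.toReal_ofReal (studentTPDF_nonneg hν φ _)]

/-- The normalizing constant of the Student density. -/
noncomputable def studentTConst (φ : ℝ≥0) (ν : ℝ) : ℝ :=
  Real.Gamma ((ν + 1) / 2) / (Real.Gamma (ν / 2) * √(ν * Real.pi * φ))

theorem studentTConst_pos (hφ : 0 < φ) (hν : 0 < ν) : 0 < studentTConst φ ν := by
  have h1 : 0 < Real.Gamma ((ν + 1) / 2) := Real.Gamma_pos_of_pos (by linarith)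
  have h2 : 0 < Real.Gamma (ν / 2) := Real.Gamma_pos_of_pos (by linarith)
  have h3 : (0 : ℝ) < φ := by exact_mod_cast hφ
  have := Real.pi_pos
  unfold studentTConst
  positivity

theorem studentTPDF_mul_pow (φ : ℝ≥0) (ν : ℝ) (k : ℕ) (x : ℝ) :
    studentTPDF φ ν x * x ^ k =
      studentTConst φ ν * (x ^ k * (1 + x ^ 2 / (ν * φ)) ^ (-((ν + 1) / 2))) := by
  rw [studentTPDF, studentTConst]
  ring

theorem integrable_pow_studentT (hφ : 0 < φ) {k : ℕ} (hν : 0 < ν) (hk : k < ν) :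
    Integrable (fun x ↦ x ^ k) (studentT φ ν) := by
  have h3 : (0 : ℝ) < φ := by exact_mod_cast hφ
  rw [integrable_studentT_iff hν]
  simp_rw [studentTPDF_mul_pow]
  exact (integrable_pow_mul_one_add_sq_div_rpow (by positivity) (by linarith)).const_mul _

theorem not_integrable_pow_studentT (hφ : 0 < φ) {k : ℕ} (hν : 0 < ν) (hk : ν ≤ k) :
    ¬ Integrable (fun x ↦ x ^ k) (studentT φ ν) := by
  have h3 : (0 : ℝ) < φ := by exact_mod_cast hφ
  rw [integrable_studentT_iff hν]
  simp_rw [studentTPDF_mul_pow]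
  rw [integrable_const_mul_iff (studentTConst_pos hφ hν).ne'.isUnit]
  exact not_integrable_pow_mul_one_add_sq_div_rpow (by positivity) (by linarith) (by linarith)

/-- The kernel recursion with c = νφ and s = (ν + 1)/2; the normalizing constant multiplies both
sides. -/
theorem integral_pow_add_two_studentT (hφ : 0 < φ) {k : ℕ} (hk : k + 2 < ν) :
    ∫ x, x ^ (k + 2) ∂(studentT φ ν) =
      (k + 1) * (ν * φ) / (ν - 2 - k) * ∫ x, x ^ k ∂(studentT φ ν) := by
  have h3 : (0 : ℝ) < φ := by exact_mod_cast hφ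
  have hk0 : (0 : ℝ) ≤ k := Nat.cast_nonneg k
  have hν : 0 < ν := by linarith
  have hne : ν - 2 - k ≠ 0 := by linarith
  have h := integral_pow_add_two_mul_one_add_sq_div_rpow (c := ν * φ) (by positivity)
    (s := (ν + 1) / 2) (k := k) (by linarith)
  have e : 2 * ((ν + 1) / 2) - 3 - (k : ℝ) = ν - 2 - k := by ring
  rw [e] at h
  simp only [integral_studentT hν, studentTPDF_mul_pow, integral_const_mul]
  rw [div_mul_eq_mul_div, eq_div_iff hne]
  linear_combination studentTConst φ ν * h

theorem integral_pow_one_studentT (hν : 0 < ν) (φ : ℝ≥0) :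
    ∫ x, x ^ 1 ∂(studentT φ ν) = 0 := by
  simp only [integral_studentT hν, studentTPDF_mul_pow, integral_const_mul]
  simp [integral_mul_one_add_sq_div_rpow]

/-- Total mass one is an instance argument: it will follow from `HasLaw` under a probability
measure, with no Beta integral to evaluate. -/
theorem integral_pow_two_studentT [IsProbabilityMeasure (studentT φ ν)] (hφ : 0 < φ)
    (hν : 2 < ν) : ∫ x, x ^ 2 ∂(studentT φ ν) = ν * φ / (ν - 2) := by
  have := integral_pow_add_two_studentT hφ (k := 0) (ν := ν) (by simpa using hν)
  simpa using this

theorem integral_pow_four_studentT [IsProbabilityMeasure (studentT φ ν)] (hφ : 0 < φ)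
    (hν : 4 < ν) :
    ∫ x, x ^ 4 ∂(studentT φ ν) = 3 * (ν * φ) ^ 2 / ((ν - 2) * (ν - 4)) := by
  have h2 : ν - 2 ≠ 0 := by linarith
  have h4 : ν - 4 ≠ 0 := by linarith
  rw [integral_pow_add_two_studentT hφ (k := 2) (by norm_num; linarith),
    integral_pow_two_studentT hφ (by linarith)]
  have h22 : ν - 2 - (2 : ℕ) = ν - 4 := by push_cast; ring
  rw [h22]
  field_simp
  norm_num

end StudentMoments

/-! ### Almost sure behaviour for Student data. -/

section StudentKurtosis

variable {Ω : Type*} [MeasurableSpace Ω] {P : Measure Ω} {y : ℕ → Ω → ℝ}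
  {φ : ℝ≥0} {ν : ℝ}

theorem tendsto_sampleMoment_studentT (hindep : iIndepFun y P) (hφ : 0 < φ) (hν : 0 < ν)
    (hy : ∀ τ, HasLaw (y τ) (studentT φ ν) P) {k : ℕ} (hk : k < ν) :
    ∀ᵐ ω ∂P, Tendsto (fun n : ℕ ↦ (∑ i ∈ Finset.range n, y i ω ^ k) / n) atTop
      (𝓝 (∫ x, x ^ k ∂(studentT φ ν))) :=
  tendsto_sum_div_ae hindep hy (measurable_id.pow_const k) (integrable_pow_studentT hφ hν hk)

theorem tendsto_sampleMean_studentT (hindep : iIndepFun y P) (hφ : 0 < φ) (hν : 1 < ν)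
    (hy : ∀ τ, HasLaw (y τ) (studentT φ ν) P) :
    ∀ᵐ ω ∂P, Tendsto (fun n : ℕ ↦ (∑ i ∈ Finset.range n, y i ω) / n) atTop (𝓝 0) := by
  have h := tendsto_sampleMoment_studentT hindep hφ (by linarith) hy (k := 1) (by simpa using hν)
  rw [integral_pow_one_studentT (by linarith)] at h
  simpa using h

variable [IsProbabilityMeasure P]

theorem tendsto_centralSampleMoment_two_studentT (hindep : iIndepFun y P) (hφ : 0 < φ)
    (hν : 2 < ν) (hy : ∀ τ, HasLaw (y τ) (studentT φ ν) P) :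
    ∀ᵐ ω ∂P, Tendsto (fun n : ℕ ↦ centralSampleMoment 2 n (fun τ ↦ y τ ω)) atTop
      (𝓝 (ν * φ / (ν - 2))) := by
  have : IsProbabilityMeasure (studentT φ ν) := (hy 0).isProbabilityMeasure_iff.1 inferInstance
  have h2 := tendsto_sampleMoment_studentT hindep hφ (by linarith) hy (k := 2) (by simpa using hν)
  rw [integral_pow_two_studentT hφ hν] at h2
  filter_upwards [tendsto_sampleMean_studentT hindep hφ (by linarith) hy, h2] with ω h1 h2
  simp_rw [centralSampleMoment_two]
  simpa using h2.sub (h1.pow 2)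

theorem tendsto_sampleKurtosis_studentT (hindep : iIndepFun y P) (hφ : 0 < φ)
    (hν : 4 < ν) (hy : ∀ τ, HasLaw (y τ) (studentT φ ν) P) :
    ∀ᵐ ω ∂P, Tendsto (fun n : ℕ ↦ sampleKurtosis n (fun τ ↦ y τ ω)) atTop
      (𝓝 (3 * ((ν - 2) / (ν - 4)))) := by
  have : IsProbabilityMeasure (studentT φ ν) := (hy 0).isProbabilityMeasure_iff.1 inferInstance
  have hφ' : (0 : ℝ) < φ := by exact_mod_cast hφ
  have hν0 : 0 < ν := by linarith
  have hν2 : 0 < ν - 2 := by linarith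
  have hν4 : 0 < ν - 4 := by linarith
  have hM := fun k hk ↦ tendsto_sampleMoment_studentT hindep hφ hν0 hy (k := k) hk
  have h4 := hM 4 (by simpa using hν)
  rw [integral_pow_four_studentT hφ hν] at h4
  filter_upwards [tendsto_sampleMean_studentT hindep hφ (by linarith) hy,
    hM 2 (by norm_num; linarith), hM 3 (by norm_num; linarith), h4,
    tendsto_centralSampleMoment_two_studentT hindep hφ (by linarith) hy] with ω h1 h2 h3 h4 hc
  have hnum : Tendsto (fun n : ℕ ↦ centralSampleMoment 4 n (fun τ ↦ y τ ω)) atTop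
      (𝓝 (3 * (ν * φ) ^ 2 / ((ν - 2) * (ν - 4)))) := by
    simp_rw [centralSampleMoment_four]
    simpa using ((h4.sub ((h1.const_mul 4).mul h3)).add (((h1.pow 2).const_mul 6).mul h2)).sub
      ((h1.pow 4).const_mul 3)
  have hlim : 3 * ((ν - 2) / (ν - 4)) =
      3 * (ν * φ) ^ 2 / ((ν - 2) * (ν - 4)) / (ν * φ / (ν - 2)) ^ 2 := by
    field_simp
  rw [hlim]
  exact hnum.div (hc.pow 2) (by positivity)

theorem tendsto_sampleKurtosis_atTop_studentT (hindep : iIndepFun y P) (hφ : 0 < φ)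
    (hν : 2 < ν) (hν4 : ν ≤ 4) (hy : ∀ τ, HasLaw (y τ) (studentT φ ν) P) :
    ∀ᵐ ω ∂P, Tendsto (fun n : ℕ ↦ sampleKurtosis n (fun τ ↦ y τ ω)) atTop atTop := by
  have hφ' : (0 : ℝ) < φ := by exact_mod_cast hφ
  have hν0 : 0 < ν := by linarith
  have hν2 : 0 < ν - 2 := by linarith
  have h4 := tendsto_sum_div_atTop_ae hindep hy (measurable_id.pow_const 4)
    (fun x ↦ by simp only [id]; positivity)
    (not_integrable_pow_studentT hφ (k := 4) hν0 (by simpa using hν4))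
  filter_upwards [tendsto_sampleMean_studentT hindep hφ (by linarith) hy, h4,
    tendsto_centralSampleMoment_two_studentT hindep hφ hν hy] with ω h1 h4 hc
  have hnum : Tendsto (fun n : ℕ ↦ centralSampleMoment 4 n (fun τ ↦ y τ ω)) atTop atTop := by
    refine tendsto_atTop_mono (fun n ↦ centralSampleMoment_four_ge n _) ?_
    simp_rw [sub_eq_add_neg]
    exact (h4.atTop_div_const (by norm_num)).atTop_add (h1.pow 4).neg
  simp only [sampleKurtosis, div_eq_mul_inv]
  exact hnum.atTop_mul_pos (by positivity) ((hc.pow 2).inv₀ (by positivity))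

theorem tendsto_sqrt_mul_sampleKurtosis_studentT (hindep : iIndepFun y P) (hφ : 0 < φ)
    (hν : 2 < ν) (hy : ∀ τ, HasLaw (y τ) (studentT φ ν) P) :
    ∀ᵐ ω ∂P, Tendsto
      (fun n : ℕ ↦ √(n : ℝ) * (sampleKurtosis n (fun τ ↦ y τ ω) - 3)) atTop atTop := by
  have hsqrt : Tendsto (fun n : ℕ ↦ √(n : ℝ)) atTop atTop :=
    Real.tendsto_sqrt_atTop.comp tendsto_natCast_atTop_atTop
  -- The fourth moment is finite exactly when ν > 4.
  rcases le_or_gt ν 4 with h4 | h4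
  · filter_upwards [tendsto_sampleKurtosis_atTop_studentT hindep hφ hν h4 hy] with ω hω
    exact hsqrt.atTop_mul_atTop₀ (tendsto_atTop_add_const_right _ (-3) hω)
  · filter_upwards [tendsto_sampleKurtosis_studentT hindep hφ h4 hy] with ω hω
    refine hsqrt.atTop_mul_pos (C := 3 * ((ν - 2) / (ν - 4)) - 3) ?_ (hω.sub_const 3)
    have h4' : 0 < ν - 4 := by linarith
    have : 1 < (ν - 2) / (ν - 4) := by rw [one_lt_div h4']; linarith
    linarith

end StudentKurtosis

/-! ### Weak convergence of Student to Gaussian. -/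

section StudentLimit

/-- Log-convexity of Gamma at the midpoint of x and x + 1, with Γ(x + 1) = xΓ(x). -/
theorem Gamma_add_half_le {x : ℝ} (hx : 0 < x) :
    Real.Gamma (x + 1 / 2) ≤ Real.Gamma x * √x := by
  have h := Real.Gamma_mul_add_mul_le_rpow_Gamma_mul_rpow_Gamma hx (by linarith : 0 < x + 1)
    (by norm_num : (0 : ℝ) < 1 / 2) (by norm_num : (0 : ℝ) < 1 / 2) (by norm_num)
  have hG := Real.Gamma_pos_of_pos hx
  rw [Real.Gamma_add_one hx.ne', ← Real.sqrt_eq_rpow, ← Real.sqrt_eq_rpow,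
    Real.sqrt_mul hx.le, mul_comm √x, ← mul_assoc, Real.mul_self_sqrt hG.le] at h
  convert h using 2
  ring

/-- The previous bound at x + 1/2, giving the lower half of the squeeze. -/
theorem Gamma_mul_self_le {x : ℝ} (hx : 0 < x) :
    Real.Gamma x * x ≤ Real.Gamma (x + 1 / 2) * √(x + 1 / 2) := by
  have h := Gamma_add_half_le (by linarith : 0 < x + 1 / 2)
  rw [add_assoc, add_halves, Real.Gamma_add_one hx.ne'] at h
  linarith

theorem tendsto_Gamma_add_half_div :
    Tendsto (fun x ↦ Real.Gamma (x + 1 / 2) / (Real.Gamma x * √x)) atTop (𝓝 1) := by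
  have hlow : Tendsto (fun x : ℝ ↦ √(x / (x + 1 / 2))) atTop (𝓝 1) := by
    have h : Tendsto (fun x : ℝ ↦ x / (x + 1 / 2)) atTop (𝓝 1) := by
      have h1 : Tendsto (fun x : ℝ ↦ 1 - (1 / 2) / (x + 1 / 2)) atTop (𝓝 (1 - 0)) :=
        tendsto_const_nhds.sub
          (Tendsto.const_div_atTop (tendsto_atTop_add_const_right _ _ tendsto_id) _)
      rw [sub_zero] at h1
      refine h1.congr' ?_
      filter_upwards [eventually_gt_atTop 0] with x hx
      field_simp
      ring
    simpa using h.sqrt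
  refine tendsto_of_tendsto_of_tendsto_of_le_of_le' hlow tendsto_const_nhds ?_ ?_
  · filter_upwards [eventually_gt_atTop 0] with x hx
    have hG := Real.Gamma_pos_of_pos hx
    have hs : 0 < √x := Real.sqrt_pos.2 hx
    have hs' : 0 < √(x + 1 / 2) := Real.sqrt_pos.2 (by linarith)
    have h := Gamma_mul_self_le hx
    rw [Real.sqrt_div hx.le, div_le_div_iff₀ hs' (by positivity)]
    calc √x * (Real.Gamma x * √x) = Real.Gamma x * (√x * √x) := by ring
      _ = Real.Gamma x * x := by rw [Real.mul_self_sqrt hx.le]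
      _ ≤ _ := h
  · filter_upwards [eventually_gt_atTop 0] with x hx
    have hG := Real.Gamma_pos_of_pos hx
    have hs : 0 < √x := Real.sqrt_pos.2 hx
    exact div_le_one_of_le₀ (Gamma_add_half_le hx) (by positivity)

variable {φ : ℝ≥0}

theorem studentTConst_eq (φ : ℝ≥0) {ν : ℝ} (hν : 0 < ν) :
    studentTConst φ ν = Real.Gamma (ν / 2 + 1 / 2) / (Real.Gamma (ν / 2) * √(ν / 2)) *
      (√(2 * Real.pi * φ))⁻¹ := by
  have h : ν * Real.pi * φ = ν / 2 * (2 * Real.pi * φ) := by ring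
  rw [studentTConst, h, Real.sqrt_mul (by positivity), add_div]
  field_simp

theorem studentTConst_le (φ : ℝ≥0) {ν : ℝ} (hν : 0 < ν) :
    studentTConst φ ν ≤ (√(2 * Real.pi * φ))⁻¹ := by
  have hν' : 0 < ν / 2 := by linarith
  have hG := Real.Gamma_pos_of_pos hν'
  rw [studentTConst_eq φ hν]
  exact mul_le_of_le_one_left (by positivity)
    (div_le_one_of_le₀ (Gamma_add_half_le hν') (by positivity))

theorem tendsto_studentTConst (φ : ℝ≥0) :
    Tendsto (studentTConst φ) atTop (𝓝 (√(2 * Real.pi * φ))⁻¹) := by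
  have h := (tendsto_Gamma_add_half_div.comp
    (tendsto_id.atTop_div_const (two_pos (α := ℝ)))).mul_const (√(2 * Real.pi * φ))⁻¹
  rw [one_mul] at h
  refine h.congr' ?_
  filter_upwards [eventually_gt_atTop 0] with ν hν
  rw [studentTConst_eq φ hν]
  rfl

theorem tendsto_studentTPDF (φ : ℝ≥0) (x : ℝ) :
    Tendsto (fun ν ↦ studentTPDF φ ν x) atTop (𝓝 (gaussianPDFReal 0 φ x)) := by
  have h1 := Real.tendsto_one_add_div_rpow_exp (x ^ 2 / φ)
  have h2 : Tendsto (fun ν : ℝ ↦ 1 + x ^ 2 / φ / ν) atTop (𝓝 1) := by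
    simpa using (tendsto_const_nhds (x := x ^ 2 / (φ : ℝ))).div_atTop tendsto_id |>.const_add 1
  -- With u = x²/φ, (1 + u/ν)^(-(ν+1)/2) is the power -1/2 of (1 + u/ν)^ν (1 + u/ν).
  have h3 := ((h1.mul h2).rpow_const (p := -(1 / 2)) (.inl (by positivity)))
  have h4 := (tendsto_studentTConst φ).mul h3
  have hlim : gaussianPDFReal 0 φ x =
      (√(2 * Real.pi * φ))⁻¹ * (Real.exp (x ^ 2 / φ) * 1) ^ (-(1 / 2) : ℝ) := by
    rw [gaussianPDFReal, mul_one, ← Real.exp_mul]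
    congr 2
    rw [sub_zero, neg_div, mul_neg, ← div_div, div_right_comm]
    ring
  rw [hlim]
  refine h4.congr' ?_
  filter_upwards [eventually_gt_atTop 0] with ν hν
  have hp : 0 < 1 + x ^ 2 / φ / ν := by positivity
  have hs : 1 + x ^ 2 / (ν * φ) = 1 + x ^ 2 / φ / ν := by rw [div_div, mul_comm ν]
  rw [studentTPDF, hs, ← studentTConst]
  congr 1
  nth_rewrite 2 [← Real.rpow_one (1 + x ^ 2 / φ / ν)]
  rw [← Real.rpow_add hp, ← Real.rpow_mul hp.le]
  congr 1
  ring

/-- Bernoulli with exponent (ν + 1)/2, at least 1 because ν ≥ 1, yields a Cauchy-type bound free of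
ν, as dominated convergence requires. -/
theorem studentTPDF_le (hφ : 0 < φ) {ν : ℝ} (hν : 1 ≤ ν) (x : ℝ) :
    studentTPDF φ ν x ≤ (√(2 * Real.pi * φ))⁻¹ * (1 + x ^ 2 / (2 * φ)) ^ (-1 : ℝ) := by
  have hφ' : (0 : ℝ) < φ := by exact_mod_cast hφ
  have hν0 : 0 < ν := by linarith
  rw [studentTPDF, ← studentTConst]
  refine mul_le_mul (studentTConst_le φ hν0) ?_ (by positivity) (by positivity)
  rw [Real.rpow_neg (by positivity), Real.rpow_neg (by positivity), Real.rpow_one]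
  refine inv_anti₀ (by positivity) ?_
  have hu : 0 ≤ x ^ 2 / (ν * φ) := by positivity
  have h := one_add_mul_self_le_rpow_one_add (s := x ^ 2 / (ν * φ)) (by linarith)
    (p := (ν + 1) / 2) (by linarith)
  refine le_trans ?_ h
  have e : x ^ 2 / (2 * φ) = ν / 2 * (x ^ 2 / (ν * φ)) := by field_simp
  rw [e]
  gcongr
  linarith

/-- The Student distribution converges weakly to the Gaussian one as the number of degrees of
freedom tends to infinity. -/
theorem tendsto_integral_studentT (hφ : 0 < φ) (f : ℝ →ᵇ ℝ) :
    Tendsto (fun ν : ℝ ↦ ∫ x, f x ∂(studentT φ ν)) atTop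
      (𝓝 (∫ x, f x ∂(gaussianReal 0 φ))) := by
  have hφ' : (0 : ℝ) < φ := by exact_mod_cast hφ
  rw [integral_gaussianReal_eq_integral_smul hφ.ne']
  simp only [smul_eq_mul]
  have hdom : Tendsto (fun ν : ℝ ↦ ∫ x, studentTPDF φ ν x * f x) atTop
      (𝓝 (∫ x, gaussianPDFReal 0 φ x * f x)) := by
    refine tendsto_integral_filter_of_dominated_convergence
      (fun x ↦ (√(2 * Real.pi * φ))⁻¹ * (1 + x ^ 2 / (2 * φ)) ^ (-1 : ℝ) * ‖f‖) ?_ ?_ ?_ ?_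
    · exact .of_forall fun ν ↦
        ((measurable_studentTPDF φ ν).mul f.continuous.measurable).aestronglyMeasurable
    · filter_upwards [eventually_ge_atTop 1] with ν hν
      refine ae_of_all _ fun x ↦ ?_
      rw [norm_mul, Real.norm_of_nonneg (studentTPDF_nonneg (by linarith) φ x)]
      exact mul_le_mul (studentTPDF_le hφ hν x) (f.norm_coe_le_norm x) (norm_nonneg _)
        (by positivity)
    · exact ((integrable_one_add_sq_div_rpow (by positivity) (by norm_num)).const_mul _).mul_const _
    · exact ae_of_all _ fun x ↦ (tendsto_studentTPDF φ x).mul_const _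
  refine hdom.congr' ?_
  filter_upwards [eventually_gt_atTop 0] with ν hν
  rw [integral_studentT hν]

end StudentLimit

theorem theorem1 {Ω : Type*} [MeasurableSpace Ω] (P : Measure Ω) [IsProbabilityMeasure P]
    (y : ℕ → Ω → ℝ) (hindep : iIndepFun y P) :
    -- Gaussian data
    (∀ φN : ℝ≥0, 0 < φN → (∀ τ, HasLaw (y τ) (gaussianReal 0 φN) P) →
      TendstoInDistribution
        (fun (n : ℕ) (ω : Ω) ↦ √(n : ℝ) * (sampleKurtosis n (fun τ ↦ y τ ω) - 3))
        atTop (id : ℝ → ℝ) (fun _ ↦ P) (gaussianReal 0 24)) ∧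
    -- Student data with finite positive variance
    (∀ (φT : ℝ≥0) (ν : ℝ), 0 < φT → 2 < ν → (∀ τ, HasLaw (y τ) (studentT φT ν) P) →
      (∀ᵐ ω ∂P, Tendsto
        (fun n : ℕ ↦ √(n : ℝ) * (sampleKurtosis n (fun τ ↦ y τ ω) - 3)) atTop atTop) ∧
      (4 < ν → ∀ᵐ ω ∂P, Tendsto
        (fun n : ℕ ↦ sampleKurtosis n (fun τ ↦ y τ ω)) atTop
        (𝓝 (3 * ((ν - 2) / (ν - 4)))))) ∧
    -- the Gaussian model is the weak limit of the Student model as `ν → ∞`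
    (∀ φ : ℝ≥0, 0 < φ → ∀ f : ℝ →ᵇ ℝ,
      Tendsto (fun ν : ℝ ↦ ∫ x, f x ∂(studentT φ ν)) atTop
        (𝓝 (∫ x, f x ∂(gaussianReal 0 φ)))) := by
  refine ⟨fun φN hφ hy ↦ ?_, fun φT ν hφ hν hy ↦ ⟨?_, fun h4 ↦ ?_⟩, fun φ hφ f ↦ ?_⟩
  · exact tendstoInDistribution_sqrt_mul_sampleKurtosis_gaussian hindep hφ.ne' hy
  · exact tendsto_sqrt_mul_sampleKurtosis_studentT hindep hφ hν hy
  · exact tendsto_sampleKurtosis_studentT hindep hφ h4 hy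
  · exact tendsto_integral_studentT hφ f
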